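/- Let $G$ be a finite simple graph on $n$ vertices, not necessarily bipartite. Write $\mu(G)$ for the maximum size of a matching in $G$, and, for disjoint vertex sets $A,B$, write $G[A,B]$ for the bipartite subgraph consisting of the edges of $G$ between $A$ and $B$. A subgraph $H$ of $G$ on the same vertex set is an $\alpha$-matching cover of $G$ if $\mu(H[A,B]) \ge \mu(G[A,B]) - \alpha n$ for all disjoint vertex subsets $A,B$. For integers $r,t\ge 1$, a graph is an $(r,t)$-Ruzsa--Szemerédi graph if its edge set can be partitioned into $t$ induced matchings, each with exactly $r$ edges (a matching is induced if the graph has no further edges between the endpoints of the matching). For $n \ge 1$ and $\beta\in(0,1/2)$ let $\mathrm{RS}(n,\beta)$ be the maximum number of edges of an $n$-vertex graph that is an $(r,t)$-Ruzsa--Szemerédi graph with $r=\lceil \beta n\rceil$ and some $t\ge 1$ (and $\mathrm{RS}(n,\beta)=0$ if there is no such graph). **Proposition.** There is an absolute constant $C>0$ such that for every $\alpha\in(0,1)$ and every integer $n\ge 1$, every $n$-vertex graph has an $\alpha$-matching cover with at most $$\mathrm{RS}(n,\alpha/8)\cdot C\log(1/\alpha)$$ edges. -/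

import Mathlib

namespace MatchingCover

/-- `μ(G)`: the maximum number of edges of a matching in `G`. -/
noncomputable def matchingNumber {V : Type*} (G : SimpleGraph V) : ℕ :=
  sSup {k | ∃ M : G.Subgraph, M.IsMatching ∧ M.edgeSet.ncard = k}

/-- `H` is an `α`-matching cover of the graph `G` on the finite vertex set `V`: it is a subgraph
of `G`, and `μ(H[A,B]) ≥ μ(G[A,B]) - α n` for all disjoint `A, B ⊆ V`, where `n = |V|` and
`G[A,B]` is the bipartite subgraph of the edges of `G` between `A` and `B`. -/
def IsMatchingCover {V : Type*} [Fintype V] (α : ℝ) (G H : SimpleGraph V) : Prop :=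
  H ≤ G ∧ ∀ A B : Set V, Disjoint A B →
    (matchingNumber (H.between A B) : ℝ) ≥
      (matchingNumber (G.between A B) : ℝ) - α * (Fintype.card V : ℝ)

/-- `M` is an induced matching of `G`: a matching such that the only edges of `G` between
vertices of `M` are the edges of `M`. -/
def IsInducedMatching {V : Type*} {G : SimpleGraph V} (M : G.Subgraph) : Prop :=
  M.IsMatching ∧ M.IsInduced

/-- `G` is an `(r,t)`-Ruzsa–Szemerédi graph, `r, t ≥ 1`: its edge set is partitioned into `t`
induced matchings with exactly `r` edges each. -/
def IsRSGraph {V : Type*} (G : SimpleGraph V) (r t : ℕ) : Prop :=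
  1 ≤ r ∧ 1 ≤ t ∧ ∃ M : Fin t → G.Subgraph,
    (∀ i, IsInducedMatching (M i) ∧ (M i).edgeSet.ncard = r) ∧
    (∀ i j, i ≠ j → Disjoint (M i).edgeSet (M j).edgeSet) ∧
    (⋃ i, (M i).edgeSet) = G.edgeSet

/-- `RS(n, β)`: the maximum number of edges of an `n`-vertex Ruzsa–Szemerédi graph whose
induced matchings have size `β n` (rounded up to an integer). It is `0` if there is no such
graph. -/
noncomputable def rsNumber (n : ℕ) (β : ℝ) : ℕ :=
  sSup {m | ∃ (G : SimpleGraph (Fin n)) (t : ℕ),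
    IsRSGraph G ⌈β * (n : ℝ)⌉₊ t ∧ G.edgeSet.ncard = m}

/-- On a finite vertex set the supremum that defines `matchingNumber` is a maximum. -/
theorem exists_matching_eq_matchingNumber {V : Type*} [Finite V] (G : SimpleGraph V) :
    BddAbove {k | ∃ M : G.Subgraph, M.IsMatching ∧ M.edgeSet.ncard = k} ∧
      ∃ M : G.Subgraph, M.IsMatching ∧ M.edgeSet.ncard = matchingNumber G := by
  have hb : BddAbove {k | ∃ M : G.Subgraph, M.IsMatching ∧ M.edgeSet.ncard = k} := by
    refine ⟨G.edgeSet.ncard, ?_⟩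
    rintro k ⟨M, -, rfl⟩
    exact Set.ncard_le_ncard M.edgeSet_subset (Set.toFinite _)
  refine ⟨hb, ?_⟩
  have hne : {k | ∃ M : G.Subgraph, M.IsMatching ∧ M.edgeSet.ncard = k}.Nonempty :=
    ⟨_, ⊥, fun v hv => hv.elim, rfl⟩
  exact Nat.sSup_mem hne hb

/-- The set whose supremum defines `rsNumber` is bounded. -/
theorem bddAbove_rsNumber (n : ℕ) (β : ℝ) :
    BddAbove {m | ∃ (G : SimpleGraph (Fin n)) (t : ℕ),
      IsRSGraph G ⌈β * (n : ℝ)⌉₊ t ∧ G.edgeSet.ncard = m} := by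
  refine ⟨(Set.univ : Set (Sym2 (Fin n))).ncard, ?_⟩
  rintro m ⟨G, t, -, rfl⟩
  exact Set.ncard_le_ncard (Set.subset_univ _) (Set.toFinite _)

end MatchingCover

/-! Let `k` be the least integer above `α n`. It suffices that `H` has an edge between the two sides
of every `k`-edge matching of `G`: otherwise the defect form of Hall's theorem yields `k` edges of a
maximum matching of `G[A,B]` whose sides `H` does not join (`isMatchingCover_of_hitting`). Such an
`H` is chosen greedily. Suppose that for some nonempty family of pairs of sides every edge of `G` is
spanned by at most a fraction `1/(4N)` of the pairs. In a random `N`-tuple from the family, an edge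
of one matching is then spanned by no other chosen pair with probability at least 3/4. A random cut
orients the surviving edges, and averaging leaves at least `N/16` matchings with `k/8` or more
edges, which form a Ruzsa–Szemerédi graph (`exists_isRSGraph_of_spread`). If `N r > 16 RS` this is
impossible, so some edge always hits a fraction `1/(4N)` of the remaining pairs. About `4 N log
(choose n k ^ 2)` edges suffice, which is of order `N k log (1/α)`, hence of order `RS log (1/α)`.
-/

namespace MatchingCover
-- Matchings as pairs of injective families
/-- Two disjoint injective families of vertices that are adjacent index by index form a matching. -/
theorem exists_matching_of_injective {V : Type*} {k : ℕ} (K : SimpleGraph V) (a b : Fin k → V)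
    (ha : Function.Injective a) (hb : Function.Injective b) (hab : ∀ x y, a x ≠ b y)
    (hK : ∀ x, K.Adj (a x) (b x)) :
    ∃ M : K.Subgraph, M.IsMatching ∧ M.verts = Set.range a ∪ Set.range b ∧
      M.edgeSet = Set.range (fun x => s(a x, b x)) ∧ M.edgeSet.ncard = k := by
  let M : K.Subgraph :=
    { verts := Set.range a ∪ Set.range b
      Adj := fun u w => ∃ x, (u = a x ∧ w = b x) ∨ (u = b x ∧ w = a x)
      adj_sub := by
        rintro u w ⟨x, ⟨rfl, rfl⟩ | ⟨rfl, rfl⟩⟩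
        exacts [hK x, (hK x).symm]
      edge_vert := by
        rintro u w ⟨x, ⟨rfl, rfl⟩ | ⟨rfl, rfl⟩⟩
        exacts [Or.inl ⟨x, rfl⟩, Or.inr ⟨x, rfl⟩]
      symm := ⟨by
        rintro u w ⟨x, ⟨rfl, rfl⟩ | ⟨rfl, rfl⟩⟩
        exacts [⟨x, Or.inr ⟨rfl, rfl⟩⟩, ⟨x, Or.inl ⟨rfl, rfl⟩⟩]⟩ }
  have hE : M.edgeSet = Set.range (fun x => s(a x, b x)) := by
    ext e
    induction e with | _ u w => ?_
    rw [SimpleGraph.Subgraph.mem_edgeSet]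
    constructor
    · rintro ⟨x, ⟨rfl, rfl⟩ | ⟨rfl, rfl⟩⟩
      exacts [⟨x, rfl⟩, ⟨x, Sym2.eq_swap⟩]
    · rintro ⟨x, hx⟩
      rcases Sym2.eq_iff.1 hx with ⟨h1, h2⟩ | ⟨h1, h2⟩
      exacts [⟨x, Or.inl ⟨h1.symm, h2.symm⟩⟩, ⟨x, Or.inr ⟨h2.symm, h1.symm⟩⟩]
  refine ⟨M, ?_, rfl, hE, ?_⟩
  · rintro v (⟨x, rfl⟩ | ⟨x, rfl⟩)
    · refine ⟨b x, ⟨x, Or.inl ⟨rfl, rfl⟩⟩, ?_⟩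
      rintro w ⟨y, ⟨h, rfl⟩ | ⟨h, -⟩⟩
      · rw [ha h]
      · exact absurd h (hab _ _)
    · refine ⟨a x, ⟨x, Or.inr ⟨rfl, rfl⟩⟩, ?_⟩
      rintro w ⟨y, ⟨h, -⟩ | ⟨h, rfl⟩⟩
      · exact absurd h.symm (hab _ _)
      · rw [hb h]
  · rw [hE, ← Set.image_univ, Set.ncard_image_of_injective, Set.ncard_univ, Nat.card_fin]
    intro x y h
    rcases Sym2.eq_iff.1 h with ⟨h1, -⟩ | ⟨h1, -⟩
    exacts [ha h1, absurd h1 (hab _ _)]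

/-- A matching between disjoint sets is given by an injective family on each side. -/
theorem exists_injective_of_matching {V : Type*} [Finite V] (G : SimpleGraph V) {A B : Set V}
    (M : (G.between A B).Subgraph) (hM : M.IsMatching) :
    ∃ a b : Fin M.edgeSet.ncard → V, Function.Injective a ∧ Function.Injective b ∧
      (∀ x, a x ∈ A) ∧ (∀ x, b x ∈ B) ∧ ∀ x, G.Adj (a x) (b x) := by
  have key : ∀ e : M.edgeSet, ∃ u w : V, e.1 = s(u, w) ∧ u ∈ A ∧ w ∈ B ∧ M.Adj u w := by
    rintro ⟨e, he⟩
    induction e with | _ u w => ?_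
    have hadj : M.Adj u w := he
    rcases (SimpleGraph.between_adj.1 hadj.adj_sub).2 with ⟨h1, h2⟩ | ⟨h1, h2⟩
    · exact ⟨u, w, rfl, h1, h2, hadj⟩
    · exact ⟨w, u, Sym2.eq_swap, h2, h1, hadj.symm⟩
  choose u w he hu hw hadj using key
  let σ : Fin M.edgeSet.ncard ≃ M.edgeSet := (Finite.equivFin M.edgeSet).symm
  have hA : ∀ e f, u e = u f → e = f := by
    intro e f h
    have h2 : w e = w f := hM.eq_of_adj_left (hadj e) (h ▸ hadj f)
    exact Subtype.ext (by rw [he, he, h, h2])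
  have hB : ∀ e f, w e = w f → e = f := by
    intro e f h
    have h2 : u e = u f := hM.eq_of_adj_right (hadj e) (h ▸ hadj f)
    exact Subtype.ext (by rw [he, he, h, h2])
  exact ⟨fun x => u (σ x), fun x => w (σ x), fun x y h => σ.injective (hA _ _ h),
    fun x y h => σ.injective (hB _ _ h), fun x => hu _, fun x => hw _,
    fun x => (SimpleGraph.between_adj.1 (hadj (σ x)).adj_sub).1⟩

theorem exists_injective_matchingNumber {V : Type*} [Finite V] (G : SimpleGraph V) (A B : Set V) :
    ∃ a b : Fin (matchingNumber (G.between A B)) → V, Function.Injective a ∧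
      Function.Injective b ∧ (∀ x, a x ∈ A) ∧ (∀ x, b x ∈ B) ∧ ∀ x, G.Adj (a x) (b x) := by
  obtain ⟨-, M, hM, h⟩ := exists_matching_eq_matchingNumber (G.between A B)
  rw [← h]
  exact exists_injective_of_matching G M hM

theorem le_matchingNumber_between {V : Type*} [Finite V] (G : SimpleGraph V) {A B : Set V}
    (hAB : Disjoint A B) {k : ℕ} (a b : Fin k → V) (ha : Function.Injective a)
    (hb : Function.Injective b) (hA : ∀ x, a x ∈ A) (hB : ∀ x, b x ∈ B)
    (hG : ∀ x, G.Adj (a x) (b x)) : k ≤ matchingNumber (G.between A B) := by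
  obtain ⟨M, hM, -, -, h⟩ := exists_matching_of_injective (G.between A B) a b ha hb
    (fun x y h => hAB.ne_of_mem (hA x) (hB y) h)
    (fun x => SimpleGraph.between_adj.2 ⟨hG x, Or.inl ⟨hA x, hB x⟩⟩)
  exact le_csSup (exists_matching_eq_matchingNumber _).1 ⟨M, hM, h⟩

/-- A family of matchings across a cut such that no edge of one of them joins vertices of another
one is the family of induced matchings of a Ruzsa–Szemerédi graph. -/
theorem isRSGraph_of_families {V : Type*} [Finite V] {r t : ℕ} (hr : 1 ≤ r) (ht : 1 ≤ t)
    (S : Set V) (a b : Fin t → Fin r → V) (ha : ∀ i, Function.Injective (a i))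
    (hb : ∀ i, Function.Injective (b i)) (hS : ∀ i x, a i x ∈ S) (hS' : ∀ i x, b i x ∉ S)
    (hind : ∀ i j x y z, a j x = a i y → b j x = b i z → j = i) :
    ∃ K : SimpleGraph V, IsRSGraph K r t ∧ K.edgeSet.ncard = t * r := by
  have hne : ∀ i x j y, a i x ≠ b j y := fun i x j y h => hS' j y (h ▸ hS i x)
  let K : SimpleGraph V :=
    { Adj := fun u w => ∃ i x, (u = a i x ∧ w = b i x) ∨ (u = b i x ∧ w = a i x)
      symm := ⟨by
        rintro u w ⟨i, x, ⟨rfl, rfl⟩ | ⟨rfl, rfl⟩⟩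
        exacts [⟨i, x, Or.inr ⟨rfl, rfl⟩⟩, ⟨i, x, Or.inl ⟨rfl, rfl⟩⟩]⟩
      loopless := ⟨by
        rintro u ⟨i, x, ⟨h1, h2⟩ | ⟨h1, h2⟩⟩
        exacts [hne i x i x (h1.symm.trans h2), hne i x i x (h2.symm.trans h1)]⟩ }
  have hM := fun i => exists_matching_of_injective K (a i) (b i) (ha i) (hb i)
    (fun x y => hne i x i y) (fun x => ⟨i, x, Or.inl ⟨rfl, rfl⟩⟩)
  choose M hM hv hE hc using hM
  have hdisj : ∀ i j, i ≠ j → Disjoint (M i).edgeSet (M j).edgeSet := by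
    intro i j hij
    rw [Set.disjoint_left]
    intro e h1 h2
    rw [hE] at h1 h2
    obtain ⟨x, rfl⟩ := h1
    obtain ⟨y, h⟩ := h2
    rcases Sym2.eq_iff.1 h with ⟨h1, h2⟩ | ⟨h1, -⟩
    · exact hij (hind i j y x x h1 h2).symm
    · exact hne _ _ _ _ h1
  have hU : (⋃ i, (M i).edgeSet) = K.edgeSet := by
    ext e
    induction e with | _ u w => ?_
    simp only [Set.mem_iUnion, hE, SimpleGraph.mem_edgeSet]
    constructor
    · rintro ⟨i, x, h⟩
      rcases Sym2.eq_iff.1 h with ⟨h1, h2⟩ | ⟨h1, h2⟩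
      exacts [⟨i, x, Or.inl ⟨h1.symm, h2.symm⟩⟩, ⟨i, x, Or.inr ⟨h2.symm, h1.symm⟩⟩]
    · rintro ⟨i, x, ⟨rfl, rfl⟩ | ⟨rfl, rfl⟩⟩
      exacts [⟨i, x, rfl⟩, ⟨i, x, Sym2.eq_swap⟩]
  have haS : ∀ i j x, a j x ∈ (M i).verts → ∃ y, a j x = a i y := by
    intro i j x h
    rw [hv] at h
    rcases h with ⟨y, h⟩ | ⟨y, h⟩
    exacts [⟨y, h.symm⟩, absurd h.symm (hne _ _ _ _)]
  have hbS : ∀ i j x, b j x ∈ (M i).verts → ∃ y, b j x = b i y := by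
    intro i j x h
    rw [hv] at h
    rcases h with ⟨y, h⟩ | ⟨y, h⟩
    exacts [absurd h (hne _ _ _ _), ⟨y, h.symm⟩]
  -- The cut rules out that an `a`-vertex of one matching is a `b`-vertex of another, so `hind`
  -- covers every way in which an edge can lie inside `M i`.
  have hadj : ∀ i j x, a j x ∈ (M i).verts → b j x ∈ (M i).verts → (M i).Adj (a j x) (b j x) := by
    intro i j x h1 h2
    obtain ⟨y, hy⟩ := haS i j x h1
    obtain ⟨z, hz⟩ := hbS i j x h2
    obtain rfl := hind i j x y z hy hz
    rw [← SimpleGraph.Subgraph.mem_edgeSet, hE]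
    exact ⟨x, rfl⟩
  refine ⟨K, ⟨hr, ht, M, fun i => ⟨⟨hM i, ?_⟩, hc i⟩, hdisj, hU⟩, ?_⟩
  · rintro u hu w hw ⟨j, x, ⟨rfl, rfl⟩ | ⟨rfl, rfl⟩⟩
    exacts [hadj i j x hu hw, (hadj i j x hw hu).symm]
  · rw [← hU, Set.ncard_iUnion_of_finite (fun i => Set.toFinite _) (fun i j h => hdisj i j h),
      finsum_eq_sum_of_fintype]
    simp [hc]
-- From hitting sets to matching covers
theorem exists_injective_fin_mem {τ : Type*} (T : Finset τ) {k : ℕ} (h : k ≤ T.card) :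
    ∃ f : Fin k → τ, Function.Injective f ∧ ∀ i, f i ∈ T :=
  ⟨fun i => T.equivFin.symm (Fin.castLE h i), fun i j hij => by
    simpa using hij, fun i => (T.equivFin.symm _).2⟩

open Classical in
/-- A subgraph with an edge across every pair of sides of a matching of size `k` is a cover. -/
theorem isMatchingCover_of_hitting {V : Type*} [Fintype V] {α : ℝ} {G H : SimpleGraph V}
    (hle : H ≤ G) {k : ℕ} (hk : (k : ℝ) ≤ α * Fintype.card V + 1)
    (hit : ∀ a b : Fin k → V, Function.Injective a → Function.Injective b →
      (∀ x y, a x ≠ b y) → (∀ x, G.Adj (a x) (b x)) → ∃ x y, H.Adj (a x) (b y)) :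
    IsMatchingCover α G H := by
  refine ⟨hle, fun A B hAB => ?_⟩
  by_contra! hlt
  obtain ⟨a, b, ha, hb, hA, hB, hG⟩ := exists_injective_matchingNumber G A B
  have hH := fun {l : ℕ} => le_matchingNumber_between H hAB (k := l)
  generalize matchingNumber (H.between A B) = m at *
  generalize matchingNumber (G.between A B) = g at *
  have hmk : m + k ≤ g := by
    have : (m + k : ℝ) < g + 1 := by linarith
    have : m + k < g + 1 := by exact_mod_cast this
    omega
  have hgA : g ≤ Fintype.card A := by
    simpa using Fintype.card_le_of_injective (fun x => (⟨a x, hA x⟩ : A))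
      (fun x y h => ha (congrArg Subtype.val h))
  -- Here `m + k ≤ g ≤ |A|` forces `k = 0`, and `hit` on empty families is absurd.
  by_cases hmA : Fintype.card A ≤ m
  · have hk0 : k = 0 := by omega
    subst hk0
    obtain ⟨x, -⟩ := hit Fin.elim0 Fin.elim0 (fun x => x.elim0) (fun x => x.elim0)
      (fun x => x.elim0) (fun x => x.elim0)
    exact x.elim0
  push Not at hmA
  -- Defect Hall: add `d` dummy neighbours to every vertex of `A`. A system of representatives uses
  -- at most `d` of them, leaving `m + 1` matching edges of `H`, one too many.
  let d := Fintype.card A - m - 1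
  let nb : A → Finset V := fun u => Finset.univ.filter fun w => w ∈ B ∧ H.Adj u w
  let t : A → Finset (V ⊕ Fin d) := fun u => (nb u).disjSum Finset.univ
  by_cases hall : ∀ s : Finset A, s.card ≤ (s.biUnion t).card
  · obtain ⟨f, hf, hft⟩ := (Finset.all_card_le_biUnion_card_iff_exists_injective t).1 hall
    let T : Finset A := Finset.univ.filter fun u => (f u).isLeft
    have hT : m + 1 ≤ T.card := by
      have h1 : (Finset.univ.filter fun u : A => ¬ (f u).isLeft).card ≤ d := by
        have : ((Finset.univ.filter fun u : A => ¬ (f u).isLeft).map ⟨f, hf⟩) ⊆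
            (Finset.univ : Finset (Fin d)).map ⟨Sum.inr, Sum.inr_injective⟩ := by
          intro z hz
          obtain ⟨u, hu, rfl⟩ := Finset.mem_map.1 hz
          simp only [Finset.mem_filter, Finset.mem_univ, true_and, Bool.not_eq_true,
            Sum.isLeft_eq_false, Sum.isRight_iff] at hu
          obtain ⟨y, hy⟩ := hu
          exact Finset.mem_map.2 ⟨y, Finset.mem_univ _, hy.symm⟩
        simpa using Finset.card_le_card this
      have h2 := Finset.card_filter_add_card_filter_not (s := (Finset.univ : Finset A))
        (fun u => ((f u).isLeft : Prop))
      rw [Finset.card_univ] at h2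
      change m + 1 ≤ (Finset.univ.filter fun u : A => ((f u).isLeft : Prop)).card
      omega
    obtain ⟨e, he, heT⟩ := exists_injective_fin_mem T hT
    have hw : ∀ i, ∃ w, f (e i) = Sum.inl w ∧ w ∈ B ∧ H.Adj (e i) w := by
      intro i
      obtain ⟨w, hw⟩ := Sum.isLeft_iff.1 (Finset.mem_filter.1 (heT i)).2
      have := hft (e i)
      rw [hw] at this
      exact ⟨w, hw, by simpa [t, nb] using this⟩
    choose w hw hwB hwH using hw
    have := hH (fun i => (e i : V)) w (fun i j h => he (Subtype.ext h))
      (fun i j h => he (hf (by rw [hw, hw, h]))) (fun i => (e i).2) hwB hwH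
    omega
  · push Not at hall
    obtain ⟨s, hs⟩ := hall
    have hs0 : s.Nonempty := Finset.card_pos.1 (by omega)
    have hsub : (s.biUnion nb).disjSum Finset.univ ⊆ s.biUnion t := by
      rintro (w | y) hz
      · simpa [t] using hz
      · obtain ⟨u, hu⟩ := hs0
        exact Finset.mem_biUnion.2 ⟨u, hu, by simp [t]⟩
    have hN := Finset.card_le_card hsub
    rw [Finset.card_disjSum, Finset.card_univ, Fintype.card_fin] at hN
    have hsA : s.card ≤ Fintype.card A := Finset.card_le_univ s
    -- For a Hall violator, `|N(s)| + d < |s|`. Discarding the edges that start outside `s` or end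
    -- in `N(s)` loses at most `|A| - |s| + |N(s)| ≤ m` of the `g` edges; `H` does not join the
    -- sides of the rest.
    let P1 : Finset (Fin g) := Finset.univ.filter fun x => (⟨a x, hA x⟩ : A) ∉ s
    let P2 : Finset (Fin g) := Finset.univ.filter fun x => b x ∈ s.biUnion nb
    have h1 : P1.card ≤ Fintype.card A - s.card := by
      rw [← Finset.card_compl]
      refine Finset.card_le_card_of_injOn (fun x => (⟨a x, hA x⟩ : A)) ?_ ?_
      · intro x hx
        simpa [P1] using hx
      · intro x _ y _ h
        exact ha (congrArg Subtype.val h)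
    have h2 : P2.card ≤ (s.biUnion nb).card := by
      refine Finset.card_le_card_of_injOn b ?_ hb.injOn
      intro x hx
      exact (Finset.mem_filter.1 hx).2
    have h3 : k ≤ ((P1 ∪ P2)ᶜ).card := by
      rw [Finset.card_compl, Fintype.card_fin]
      have := Finset.card_union_le P1 P2
      omega
    obtain ⟨e, he, heT⟩ := exists_injective_fin_mem _ h3
    obtain ⟨x, y, hxy⟩ := hit (a ∘ e) (b ∘ e) (ha.comp he) (hb.comp he)
      (fun x y h => hAB.ne_of_mem (hA _) (hB _) h) (fun x => hG _)
    have hx := heT x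
    have hy := heT y
    simp only [Finset.compl_union, Finset.mem_inter, Finset.mem_compl, P1, P2, Finset.mem_filter,
      Finset.mem_univ, true_and, not_not] at hx hy
    exact hy.2 (Finset.mem_biUnion.2 ⟨_, hx.1, by simpa [nb] using ⟨hB _, hxy⟩⟩)

/-! ### Greedy hitting sets -/

open Classical in
/-- The greedy hitting set. -/
theorem exists_greedy_cover {ε ι : Type*} (R : ε → ι → Prop) (P : Finset ι) {v : ℝ} (hv : v ≤ 1)
    (h : ∀ F ⊆ P, F.Nonempty → ∃ e, v * F.card ≤ (F.filter (R e)).card) (s : ℕ) :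
    ∃ E : Finset ε, E.card ≤ s ∧
      ((P.filter fun p => ∀ e ∈ E, ¬ R e p).card : ℝ) ≤ (1 - v) ^ s * P.card := by
  induction s with
  | zero => exact ⟨∅, by simp⟩
  | succ s ih =>
    obtain ⟨E, hE, hP⟩ := ih
    by_cases hF : (P.filter fun p => ∀ e ∈ E, ¬ R e p).Nonempty
    · obtain ⟨e, he⟩ := h _ (Finset.filter_subset _ _) hF
      refine ⟨insert e E, (Finset.card_insert_le _ _).trans (by omega), ?_⟩
      have h1 := Finset.card_filter_add_card_filter_not
        (s := P.filter fun p => ∀ e ∈ E, ¬ R e p) (R e)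
      have h2 : (P.filter fun p => ∀ e' ∈ insert e E, ¬ R e' p) =
          (P.filter fun p => ∀ e ∈ E, ¬ R e p).filter (fun p => ¬ R e p) := by
        ext p
        simp only [Finset.mem_filter, Finset.forall_mem_insert]
        tauto
      rw [h2]
      have h3 : (((P.filter fun p => ∀ e ∈ E, ¬ R e p).filter (R e)).card : ℝ) +
          ((P.filter fun p => ∀ e ∈ E, ¬ R e p).filter (fun p => ¬ R e p)).card =
          (P.filter fun p => ∀ e ∈ E, ¬ R e p).card := by exact_mod_cast h1
      have h4 := mul_le_mul_of_nonneg_left hP (sub_nonneg.2 hv)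
      rw [pow_succ]
      nlinarith
    · refine ⟨E, by omega, ?_⟩
      rw [Finset.not_nonempty_iff_eq_empty.1 hF]
      have := sub_nonneg.2 hv
      simp only [Finset.card_empty, Nat.cast_zero]
      positivity
-- Random cuts and random tuples, by counting
open Classical in
/-- A cut that contains at least a quarter of given edges, each oriented across it. -/
theorem exists_cut {V τ : Type*} [Fintype V] (T : Finset τ) (u w : τ → V)
    (h : ∀ t ∈ T, u t ≠ w t) :
    ∃ S : Set V, T.card ≤ 4 * (T.filter fun t => u t ∈ S ∧ w t ∉ S).card := by
  have key : ∀ t ∈ T, Fintype.card (Set V) ≤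
      4 * (Finset.univ.filter fun S : Set V => u t ∈ S ∧ w t ∉ S).card := by
    intro t ht
    -- Forcing `u t` in and `w t` out is at most four-to-one on sets, the two memberships recovering
    -- the original set.
    let g : Set V → Prop × Prop × Set V :=
      fun S => (u t ∈ S, w t ∈ S, insert (u t) S \ {w t})
    have h1 : (Finset.univ : Finset (Set V)).card ≤
        ((Finset.univ : Finset Prop) ×ˢ (Finset.univ : Finset Prop) ×ˢ
          (Finset.univ.filter fun S : Set V => u t ∈ S ∧ w t ∉ S)).card := by
      refine Finset.card_le_card_of_injOn g ?_ ?_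
      · intro S _
        simp only [g, Finset.coe_product, Finset.coe_univ, Finset.coe_filter, Finset.mem_univ,
          true_and, Set.mem_prod, Set.mem_univ, Set.mem_ofPred_eq]
        simp [h t ht]
      · intro S _ S' _ hS
        simp only [g, Prod.mk.injEq, eq_iff_iff] at hS
        obtain ⟨h1, h2, h3⟩ := hS
        ext z
        by_cases hz : z = u t
        · rw [hz, h1]
        by_cases hz' : z = w t
        · rw [hz', h2]
        have := Set.ext_iff.1 h3 z
        simpa [hz, hz'] using this
    simp only [Finset.card_product, Finset.card_univ, Fintype.card_prop] at h1
    omega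
  have hsum : ∑ _S : Set V, T.card ≤
      ∑ S : Set V, 4 * (T.filter fun t => u t ∈ S ∧ w t ∉ S).card := by
    rw [Finset.sum_const, Finset.card_univ, smul_eq_mul, ← Finset.mul_sum]
    simp only [Finset.card_filter]
    rw [Finset.sum_comm, Finset.mul_sum, mul_comm, ← smul_eq_mul, ← Finset.sum_const]
    refine Finset.sum_le_sum fun t ht => ?_
    rw [← Finset.card_filter]
    exact key t ht
  obtain ⟨S, -, hS⟩ := Finset.exists_le_of_sum_le ⟨∅, Finset.mem_univ _⟩ hsum
  exact ⟨S, hS⟩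

open Classical in
/-- If `Q p x` holds for few `q`, then in most tuples `f` the relation `Q (f i) x (f j)` fails for
all `j ≠ i`. -/
theorem card_tuples_avoiding {ι : Type*} [Fintype ι] {N : ℕ} (Q : ι → ι → Prop)
    (h : ∀ p, 4 * N * (Finset.univ.filter (Q p)).card ≤ Fintype.card ι) (i : Fin N) :
    3 * Fintype.card (Fin N → ι) ≤
      4 * (Finset.univ.filter fun f : Fin N → ι => ∀ j, j ≠ i → ¬ Q (f i) (f j)).card := by
  have hN : 1 ≤ N := i.pos
  have hcard : Fintype.card {j // j ≠ i} = N - 1 := by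
    simp [Fintype.card_subtype_compl]
  have key : ∀ p : ι, 3 * Fintype.card ι ^ (N - 1) ≤
      4 * (Finset.univ.filter fun g : {j // j ≠ i} → ι => ∀ j, ¬ Q p (g j)).card := by
    intro p
    have h1 : (Finset.univ.filter fun g : {j // j ≠ i} → ι => ∀ j, ¬ Q p (g j)) =
        Fintype.piFinset fun _ => Finset.univ.filter fun q => ¬ Q p q := by
      ext g
      simp [Fintype.mem_piFinset]
    rw [h1, Fintype.card_piFinset, Finset.prod_const, Finset.card_univ, hcard]
    have h2 := Finset.card_filter_add_card_filter_not (s := (Finset.univ : Finset ι)) (Q p)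
    rw [Finset.card_univ] at h2
    have hp := h p
    have hc : 0 < Fintype.card ι := Fintype.card_pos_iff.2 ⟨p⟩
    generalize (Finset.univ.filter (Q p)).card = x at *
    generalize (Finset.univ.filter fun q => ¬ Q p q).card = y at *
    generalize Fintype.card ι = c at *
    have hc' : (0 : ℝ) < c := by exact_mod_cast hc
    have hp' : 4 * (N : ℝ) * x ≤ c := by exact_mod_cast hp
    have hN' : (1 : ℝ) ≤ N := by exact_mod_cast hN
    have hxy : (y : ℝ) = c * (1 + -(x / c)) := by
      have : (x : ℝ) + y = c := by exact_mod_cast h2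
      field_simp
      linarith
    have hx : (N : ℝ) * (x / c) ≤ 1 / 4 := by
      rw [← mul_div_assoc, div_le_iff₀ hc']
      linarith
    have hx0 : (0 : ℝ) ≤ x / c := by positivity
    -- Bernoulli: `(1 - x/c)^(N-1) ≥ 1 - (N-1) x/c ≥ 3/4`.
    have hb := one_add_mul_le_pow (a := -((x : ℝ) / c)) (by nlinarith) (N - 1)
    rw [Nat.cast_sub hN, Nat.cast_one] at hb
    have h3 : (3 / 4 : ℝ) ≤ (1 + -((x : ℝ) / c)) ^ (N - 1) := by nlinarith
    have : (3 : ℝ) * c ^ (N - 1) ≤ 4 * y ^ (N - 1) := by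
      rw [hxy, mul_pow]
      have : (0 : ℝ) ≤ c ^ (N - 1) := by positivity
      nlinarith
    exact_mod_cast this
  have h1 : (Finset.univ.filter fun f : Fin N → ι => ∀ j, j ≠ i → ¬ Q (f i) (f j)).card =
      ∑ p : ι, (Finset.univ.filter fun g : {j // j ≠ i} → ι => ∀ j, ¬ Q p (g j)).card := by
    simp only [Finset.card_filter]
    rw [← (Equiv.funSplitAt i ι).symm.sum_comp, Fintype.sum_prod_type]
    refine Finset.sum_congr rfl fun p _ => Finset.sum_congr rfl fun g _ => ?_
    congr 1
    rw [eq_iff_iff]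
    constructor
    · intro hf j
      have := hf j.1 j.2
      simpa [Equiv.funSplitAt, Equiv.piSplitAt, j.2] using this
    · intro hf j hj
      have := hf ⟨j, hj⟩
      simpa [Equiv.funSplitAt, Equiv.piSplitAt, hj] using this
  rw [h1, Finset.mul_sum]
  refine le_trans (le_of_eq ?_) (Finset.sum_le_sum fun p _ => key p)
  rw [Finset.sum_const, Finset.card_univ, smul_eq_mul, Fintype.card_fun, Fintype.card_fin]
  obtain ⟨M, rfl⟩ : ∃ M, N = M + 1 := ⟨N - 1, by omega⟩
  rw [pow_succ, Nat.add_sub_cancel]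
  ring

open Classical in
-- Linearity of expectation: each of the `N * k` positions is good in at least 3/4 of all tuples, so
-- some tuple attains this average.
theorem exists_tuple {ι : Type*} [Fintype ι] [Nonempty ι] {N k : ℕ} (Q : Fin k → ι → ι → Prop)
    (h : ∀ x p, 4 * N * (Finset.univ.filter (Q x p)).card ≤ Fintype.card ι) :
    ∃ f : Fin N → ι, 3 * (N * k) ≤ 4 * (Finset.univ.filter fun z : Fin N × Fin k =>
      ∀ j, j ≠ z.1 → ¬ Q z.2 (f z.1) (f j)).card := by
  have hsum : ∑ _f : Fin N → ι, 3 * (N * k) ≤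
      ∑ f : Fin N → ι, 4 * (Finset.univ.filter fun z : Fin N × Fin k =>
        ∀ j, j ≠ z.1 → ¬ Q z.2 (f z.1) (f j)).card := by
    rw [Finset.sum_const, ← Finset.mul_sum]
    simp only [Finset.card_filter]
    rw [Finset.sum_comm, Finset.mul_sum]
    have := Finset.sum_le_sum (s := (Finset.univ : Finset (Fin N × Fin k)))
      fun z _ => card_tuples_avoiding (Q z.2) (h z.2) z.1
    simp only [Finset.card_filter] at this
    refine le_trans (le_of_eq ?_) this
    simp only [Finset.sum_const, Finset.card_univ, smul_eq_mul, Fintype.card_prod,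
      Fintype.card_fin]
    ring
  obtain ⟨f, -, hf⟩ := Finset.exists_le_of_sum_le Finset.univ_nonempty hsum
  exact ⟨f, hf⟩

/-! ### Ruzsa–Szemerédi graphs from spread families -/

open Classical in
/-- A family of matchings in which every edge of a matching is spanned by few of the pairs of sides
yields a Ruzsa–Szemerédi graph. -/
theorem exists_isRSGraph_of_spread {V ι : Type*} [Fintype V] [Fintype ι] [Nonempty ι]
    {n N k r : ℕ} (hn : Fintype.card V = n) (hN : 1 ≤ N) (hk : 1 ≤ k) (hr : 1 ≤ r)
    (hrk : ∀ m, k ≤ 8 * m → r ≤ m) (a b : ι → Fin k → V) (ha : ∀ p, Function.Injective (a p))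
    (hb : ∀ p, Function.Injective (b p)) (hab : ∀ p x y, a p x ≠ b p y)
    (h : ∀ p x, 4 * N * (Finset.univ.filter fun q =>
      a p x ∈ Set.range (a q) ∧ b p x ∈ Set.range (b q)).card ≤ Fintype.card ι) :
    ∃ (K : SimpleGraph (Fin n)) (t : ℕ), IsRSGraph K r t ∧ K.edgeSet.ncard = t * r ∧
      N ≤ 16 * t := by
  obtain ⟨f, hf⟩ := exists_tuple (N := N) (fun x p q => a p x ∈ Set.range (a q) ∧ b p x ∈ Set.range (b q))
    (fun x p => by convert h p x)
  -- The tuple `f` may repeat a member; its repeated matchings then span each other's edges and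
  -- contribute nothing to `T`.
  set T : Finset (Fin N × Fin k) := Finset.univ.filter fun z => ∀ j, j ≠ z.1 →
    ¬ (a (f z.1) z.2 ∈ Set.range (a (f j)) ∧ b (f z.1) z.2 ∈ Set.range (b (f j))) with hT
  have hf' : 3 * (N * k) ≤ 4 * T.card := by convert hf
  obtain ⟨S, hS⟩ := exists_cut T (fun z => a (f z.1) z.2) (fun z => b (f z.1) z.2)
    (fun z _ => hab _ _ _)
  set T' := T.filter fun z => a (f z.1) z.2 ∈ S ∧ b (f z.1) z.2 ∉ S with hT'
  let X : Fin N → Finset (Fin k) := fun i => Finset.univ.filter fun x => (i, x) ∈ T'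
  have hX : T'.card = ∑ i, (X i).card := by
    simp only [X, Finset.card_filter]
    rw [← Fintype.sum_prod_type (f := fun z : Fin N × Fin k => if z ∈ T' then 1 else 0)]
    simp
  let good : Finset (Fin N) := Finset.univ.filter fun i => k ≤ 8 * (X i).card
  -- The sum of the `|X i|` is at least `3 N k / 16`, and indices that are not good account for at
  -- most `N k / 8` of it; the remaining `N k / 16` needs at least `N / 16` good indices.
  have hbound : 8 * ∑ i, (X i).card ≤ 8 * k * good.card + k * N := by
    have h1 : ∀ i : Fin N, 8 * (X i).card ≤ (if k ≤ 8 * (X i).card then 8 * k else 0) + k := by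
      intro i
      have : (X i).card ≤ k := by simpa using Finset.card_le_univ (X i)
      split_ifs <;> omega
    rw [Finset.mul_sum]
    refine (Finset.sum_le_sum fun i _ => h1 i).trans (le_of_eq ?_)
    rw [Finset.sum_add_distrib, ← Finset.sum_filter, Finset.sum_const, Finset.sum_const]
    simp only [good, smul_eq_mul, Finset.card_univ, Fintype.card_fin]
    ring
  have hgood : N ≤ 16 * good.card := by
    have : k * N ≤ k * (16 * good.card) := by linarith
    exact Nat.le_of_mul_le_mul_left this hk
  obtain ⟨e, he, hegood⟩ := exists_injective_fin_mem good le_rfl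
  have hc : ∀ i : Fin good.card, ∃ c : Fin r → Fin k, Function.Injective c ∧
      ∀ x, c x ∈ X (e i) := fun i =>
    exists_injective_fin_mem _ (hrk _ (Finset.mem_filter.1 (hegood i)).2)
  choose c hc hcX using hc
  have hmem : ∀ i x, (e i, c i x) ∈ T' := fun i x => (Finset.mem_filter.1 (hcX i x)).2
  let σ : V ≃ Fin n := Fintype.equivFinOfCardEq hn
  obtain ⟨K, hK, hK'⟩ := isRSGraph_of_families hr (by omega : 1 ≤ good.card) (σ '' S)
    (fun i x => σ (a (f (e i)) (c i x))) (fun i x => σ (b (f (e i)) (c i x)))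
    (fun i x y hxy => hc i (ha _ (σ.injective hxy)))
    (fun i x y hxy => hc i (hb _ (σ.injective hxy)))
    (fun i x => ⟨_, (Finset.mem_filter.1 (hmem i x)).2.1, rfl⟩)
    (fun i x => by
      rintro ⟨z, hz, hz'⟩
      exact (Finset.mem_filter.1 (hmem i x)).2.2 (σ.injective hz' ▸ hz))
    (fun i j x y z h1 h2 => by
      by_contra hij
      refine (Finset.mem_filter.1 (Finset.mem_filter.1 (hmem j x)).1).2 (e i)
        (fun h => hij (he h).symm) ⟨⟨c i y, (σ.injective h1).symm⟩, ⟨c i z, (σ.injective h2).symm⟩⟩)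
  exact ⟨K, _, hK, hK', hgood⟩
-- Few edges hit all pairs of sides
theorem choose_le_exp_mul_pow {n k : ℕ} (hk : 1 ≤ k) {α : ℝ} (hα : 0 < α) (h : α * n ≤ k) :
    (n.choose k : ℝ) ≤ (Real.exp 1 / α) ^ k := by
  have h1 : (n.choose k : ℝ) ≤ (n : ℝ) ^ k / (k.factorial : ℝ) := Nat.choose_le_pow_div k n
  have h2 := Real.pow_div_factorial_le_exp (k : ℝ) (by positivity) k
  have h3 : (n : ℝ) ≤ k / α := by
    rw [le_div_iff₀ hα]
    linarith
  calc (n.choose k : ℝ) ≤ (n : ℝ) ^ k / (k.factorial : ℝ) := h1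
    _ ≤ (k / α) ^ k / (k.factorial : ℝ) := by gcongr
    _ = ((k : ℝ) ^ k / (k.factorial : ℝ)) / α ^ k := by rw [div_pow]; ring
    _ ≤ Real.exp k / α ^ k := by gcongr
    _ = _ := by rw [div_pow, ← Real.exp_nat_mul, mul_one]

/-- The pairs of sides of the matchings of `G` with `k` edges. -/
def matchingSides {V : Type*} (G : SimpleGraph V) (k : ℕ) : Set (Finset V × Finset V) :=
  {p | ∃ a b : Fin k → V, Function.Injective a ∧ Function.Injective b ∧ (∀ x y, a x ≠ b y) ∧
    (∀ x, G.Adj (a x) (b x)) ∧ (p.1 : Set V) = Set.range a ∧ (p.2 : Set V) = Set.range b}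

theorem ncard_matchingSides_le {V : Type*} [Fintype V] (G : SimpleGraph V) (k : ℕ) :
    (matchingSides G k).ncard ≤ (Fintype.card V).choose k ^ 2 := by
  classical
  have : matchingSides G k ⊆ ((Finset.univ : Finset V).powersetCard k ×ˢ
      (Finset.univ : Finset V).powersetCard k : Finset (Finset V × Finset V)) := by
    rintro ⟨A, B⟩ ⟨a, b, ha, hb, -, -, hA, hB⟩
    have h : ∀ (C : Finset V) (c : Fin k → V), Function.Injective c → (C : Set V) = Set.range c →
        C.card = k := by
      intro C c hc hC
      rw [← Set.ncard_coe_finset, hC, ← Set.image_univ, Set.ncard_image_of_injective _ hc]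
      simp
    simp [Finset.mem_powersetCard, h A a ha hA, h B b hb hB]
  refine (Set.ncard_le_ncard this (Set.toFinite _)).trans (le_of_eq ?_)
  rw [Set.ncard_coe_finset, Finset.card_product, Finset.card_powersetCard, Finset.card_univ, sq]

/-- From a nonempty family of pairs of sides for which every edge of `G` is spanned by few pairs
one gets a Ruzsa–Szemerédi graph. -/
theorem mul_le_rsNumber {V : Type*} [Fintype V] {G : SimpleGraph V} {k N : ℕ} {β : ℝ}
    (hN : 1 ≤ N) (hk : 1 ≤ k) (hr : 1 ≤ ⌈β * (Fintype.card V : ℝ)⌉₊)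
    (hrk : ∀ m, k ≤ 8 * m → ⌈β * (Fintype.card V : ℝ)⌉₊ ≤ m)
    (F : Finset (Finset V × Finset V)) (hF : F.Nonempty) (hFG : ↑F ⊆ matchingSides G k)
    (h : ∀ u w, G.Adj u w →
      4 * N * {q ∈ (F : Set (Finset V × Finset V)) | u ∈ q.1 ∧ w ∈ q.2}.ncard ≤ F.card) :
    N * ⌈β * (Fintype.card V : ℝ)⌉₊ ≤ 16 * rsNumber (Fintype.card V) β := by
  classical
  have : Nonempty F := hF.to_subtype
  have hFG' : ∀ p : F, p.1 ∈ matchingSides G k := fun p => hFG p.2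
  choose a b ha hb hab hG hA hB using hFG'
  obtain ⟨K, t, hK, hKc, ht⟩ := exists_isRSGraph_of_spread rfl hN hk hr hrk a b ha hb hab (by
    intro p x
    refine le_trans (Nat.mul_le_mul_left _ ?_) ((h _ _ (hG p x)).trans (by simp))
    rw [← Set.ncard_coe_finset]
    refine Set.ncard_le_ncard_of_injOn Subtype.val ?_ Subtype.val_injective.injOn
      (Set.toFinite _)
    intro q hq
    simp only [Finset.coe_filter, Finset.mem_univ, true_and, ← hA, ← hB] at hq
    exact ⟨q.2, hq⟩)
  have : t * ⌈β * (Fintype.card V : ℝ)⌉₊ ≤ rsNumber (Fintype.card V) β :=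
    le_csSup (bddAbove_rsNumber _ _) ⟨K, t, hK, hKc⟩
  nlinarith

/-- A single matching is a Ruzsa–Szemerédi graph with `t = 1`. This lower bound lets rounding errors
be absorbed into `RS`. -/
theorem le_rsNumber {V : Type*} [Fintype V] {k : ℕ} {β : ℝ}
    (hr : 1 ≤ ⌈β * (Fintype.card V : ℝ)⌉₊) (hrk : ⌈β * (Fintype.card V : ℝ)⌉₊ ≤ k)
    (a b : Fin k → V) (ha : Function.Injective a) (hb : Function.Injective b)
    (hab : ∀ x y, a x ≠ b y) :
    ⌈β * (Fintype.card V : ℝ)⌉₊ ≤ rsNumber (Fintype.card V) β := by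
  let σ : V ≃ Fin (Fintype.card V) := Fintype.equivFin V
  obtain ⟨K, hK, hKc⟩ := isRSGraph_of_families hr le_rfl (Set.range (σ ∘ a))
    (fun (_ : Fin 1) x => σ (a (Fin.castLE hrk x))) (fun _ x => σ (b (Fin.castLE hrk x)))
    (fun _ x y h => by simpa using ha (σ.injective h))
    (fun _ x y h => by simpa using hb (σ.injective h))
    (fun _ x => ⟨_, rfl⟩) (fun _ x ⟨y, h⟩ => hab _ _ (σ.injective h))
    (fun i j _ _ _ _ _ => Subsingleton.elim _ _)
  exact le_csSup (bddAbove_rsNumber _ _) ⟨K, 1, hK, by rw [hKc, one_mul]⟩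

/-- Every graph has few edges that hit all pairs of sides of matchings with `k` edges. -/
theorem exists_hitting_subgraph {V : Type*} [Fintype V] (G : SimpleGraph V) {k N : ℕ} {β : ℝ}
    (hN : 1 ≤ N) (hk : 1 ≤ k) (hr : 1 ≤ ⌈β * (Fintype.card V : ℝ)⌉₊)
    (hrk : ∀ m, k ≤ 8 * m → ⌈β * (Fintype.card V : ℝ)⌉₊ ≤ m)
    (hlt : 16 * rsNumber (Fintype.card V) β < N * ⌈β * (Fintype.card V : ℝ)⌉₊)
    (s : ℕ) (hs : 4 * N * Real.log (matchingSides G k).ncard < s) :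
    ∃ H : SimpleGraph V, H ≤ G ∧ H.edgeSet.ncard ≤ s ∧
      ∀ p ∈ matchingSides G k, ∃ u ∈ p.1, ∃ w ∈ p.2, H.Adj u w := by
  classical
  let P : Finset (Finset V × Finset V) := (matchingSides G k).toFinset
  have hP : P.card = (matchingSides G k).ncard := (Set.ncard_eq_toFinset_card' _).symm
  have hN' : (1 : ℝ) ≤ N := by exact_mod_cast hN
  set v : ℝ := 1 / (4 * N) with hv
  have hv0 : 0 < v := by positivity
  have hv1 : v ≤ 1 := by
    rw [hv, div_le_one (by positivity)]
    linarith
  obtain ⟨E, hE, hEP⟩ := exists_greedy_cover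
    (fun (e : {e : V × V // G.Adj e.1 e.2}) (p : Finset V × Finset V) =>
      e.1.1 ∈ p.1 ∧ e.1.2 ∈ p.2) P hv1 (by
    intro F hFP hF
    by_contra! hcon
    refine absurd (mul_le_rsNumber hN hk hr hrk F hF (fun p hp => by simpa [P] using hFP hp) ?_)
      hlt.not_ge
    intro u w huw
    have hlt' := hcon ⟨(u, w), huw⟩
    have this : ({q ∈ (F : Set (Finset V × Finset V)) | u ∈ q.1 ∧ w ∈ q.2}.ncard : ℝ) ≤
        v * F.card := by
      refine (le_of_eq ?_).trans hlt'.le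
      rw [← Set.ncard_coe_finset]
      simp
    rw [hv, div_mul_eq_mul_div, one_mul, le_div_iff₀ (by positivity)] at this
    have h3 : {q ∈ (F : Set (Finset V × Finset V)) | u ∈ q.1 ∧ w ∈ q.2}.ncard *
      (4 * N) ≤ F.card := by exact_mod_cast this
    rwa [mul_comm]) s
  have hEP' : ((P.filter fun p => ∀ e ∈ E, ¬ (e.1.1 ∈ p.1 ∧ e.1.2 ∈ p.2)).card : ℝ) ≤
      (1 - v) ^ s * P.card := by convert hEP
  -- The number of pairs left is at most `(1 - v)^s |P| ≤ exp (-s v) |P| < 1`, by the choice of `s`.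
  have hempty : (P.filter fun p => ∀ e ∈ E, ¬ (e.1.1 ∈ p.1 ∧ e.1.2 ∈ p.2)) = ∅ := by
    rw [← Finset.card_eq_zero]
    by_contra h0
    have h1 : (1 : ℝ) ≤ (P.filter fun p => ∀ e ∈ E, ¬ (e.1.1 ∈ p.1 ∧ e.1.2 ∈ p.2)).card := by
      exact_mod_cast Nat.one_le_iff_ne_zero.2 h0
    have hPpos : 0 < P.card := by
      refine lt_of_lt_of_le (Nat.pos_of_ne_zero h0) (Finset.card_le_card (Finset.filter_subset _ _))
    have hPpos' : (0 : ℝ) < P.card := by exact_mod_cast hPpos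
    have h2 : (1 - v) ^ s ≤ Real.exp (-(s * v)) := by
      rw [← mul_neg, Real.exp_nat_mul]
      exact pow_le_pow_left₀ (sub_nonneg.2 hv1) (Real.one_sub_le_exp_neg v) s
    have h3 : Real.log P.card < s * v := by
      rw [hP, hv, mul_one_div, lt_div_iff₀ (by positivity)]
      linarith
    have h4 : (P.card : ℝ) < Real.exp (s * v) := (Real.log_lt_iff_lt_exp hPpos').1 h3
    have h5 : Real.exp (-(s * v)) * P.card < 1 := by
      rw [Real.exp_neg, inv_mul_lt_iff₀ (Real.exp_pos _), mul_one]
      exact h4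
    have h6 := mul_le_mul_of_nonneg_right h2 hPpos'.le
    linarith
  let D : Set (Sym2 V) := (fun e : {e : V × V // G.Adj e.1 e.2} => s(e.1.1, e.1.2)) '' E
  have hDG : D ⊆ G.edgeSet := by
    rintro _ ⟨e, -, rfl⟩
    exact e.2
  have hedge : (SimpleGraph.fromEdgeSet D).edgeSet = D := by
    rw [SimpleGraph.edgeSet_fromEdgeSet, sdiff_eq_left, Set.disjoint_left]
    intro e he hd
    exact G.not_isDiag_of_mem_edgeSet (hDG he) hd
  refine ⟨SimpleGraph.fromEdgeSet D, ?_, ?_, ?_⟩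
  · rw [← SimpleGraph.edgeSet_subset_edgeSet, hedge]
    exact hDG
  · rw [hedge]
    refine (Set.ncard_image_le (Finset.finite_toSet E)).trans ?_
    rwa [Set.ncard_coe_finset]
  · intro p hp
    by_contra! hcon
    have : p ∈ (∅ : Finset (Finset V × Finset V)) := by
      rw [← hempty, Finset.mem_filter]
      refine ⟨by simpa [P] using hp, fun e he hep => hcon _ hep.1 _ hep.2 ?_⟩
      rw [← SimpleGraph.mem_edgeSet, hedge]
      exact ⟨e, he, rfl⟩
    simp at this

/-! ### The choice of parameters -/

/-- A matching has at most `n / 2` edges. This settles `α ≥ 1/2`, where `log (1/α)` may be too small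
to absorb constants. -/
theorem isMatchingCover_bot {V : Type*} [Fintype V] {α : ℝ} (hα : 1 / 2 ≤ α)
    (G : SimpleGraph V) : IsMatchingCover α G ⊥ := by
  refine ⟨bot_le, fun A B hAB => ?_⟩
  obtain ⟨a, b, ha, hb, hA, hB, -⟩ := exists_injective_matchingNumber G A B
  have h := Fintype.card_le_of_injective (Sum.elim a b)
    (ha.sumElim hb fun x y => hAB.ne_of_mem (hA x) (hB y))
  rw [Fintype.card_sum, Fintype.card_fin] at h
  have h' : (matchingNumber (G.between A B) : ℝ) + matchingNumber (G.between A B) ≤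
    Fintype.card V := by exact_mod_cast h
  have h0 : (0 : ℝ) ≤ matchingNumber ((⊥ : SimpleGraph V).between A B) := by positivity
  have hV : (0 : ℝ) ≤ Fintype.card V := by positivity
  nlinarith

theorem exists_matchingCover {V : Type*} [Fintype V] {α : ℝ} (hα : 0 < α) (hα' : α < 1 / 2)
    (hV : 1 ≤ Fintype.card V) (G : SimpleGraph V) :
    ∃ H : SimpleGraph V, IsMatchingCover α G H ∧
      (H.edgeSet.ncard : ℝ) ≤
        (rsNumber (Fintype.card V) (α / 8) : ℝ) * (4000 * Real.log (1 / α)) := by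
  set n := Fintype.card V with hn
  have hn' : (1 : ℝ) ≤ n := by exact_mod_cast hV
  set k := ⌊α * n⌋₊ + 1 with hk
  have hk1 : (k : ℝ) ≤ α * n + 1 := by
    rw [hk]; push_cast
    linarith [Nat.floor_le (show 0 ≤ α * (n : ℝ) by positivity)]
  have hk2 : α * n ≤ k := by
    rw [hk]; push_cast
    exact (Nat.lt_floor_add_one _).le
  set r := ⌈α / 8 * (n : ℝ)⌉₊ with hrdef
  have hr : 1 ≤ r := Nat.one_le_iff_ne_zero.2 (Nat.ceil_pos.2 (by positivity)).ne'
  have hr' : α / 8 * n ≤ r := Nat.le_ceil _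
  have hrk : ∀ m, k ≤ 8 * m → r ≤ m := by
    intro m hm
    have : (k : ℝ) ≤ 8 * m := by exact_mod_cast hm
    exact Nat.ceil_le.2 (by linarith)
  have hlog : 1 / 2 ≤ Real.log (1 / α) := by
    have h2 : Real.log 2 ≤ Real.log (1 / α) :=
      Real.log_le_log (by norm_num) (by rw [le_div_iff₀ hα]; linarith)
    linarith [Real.log_two_gt_d9]
  set l := Real.log (1 / α) with hl
  set R := rsNumber n (α / 8) with hR
  by_cases hempty : matchingSides G k = ∅
  · refine ⟨⊥, isMatchingCover_of_hitting bot_le hk1 ?_, ?_⟩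
    · intro a b ha hb hab hG
      classical
      have : (Finset.univ.image a, Finset.univ.image b) ∈ matchingSides G k :=
        ⟨a, b, ha, hb, hab, hG, by simp, by simp⟩
      simp [hempty] at this
    · simp only [SimpleGraph.edgeSet_bot, Set.ncard_empty, Nat.cast_zero]
      positivity
  obtain ⟨p, hp⟩ := Set.nonempty_iff_ne_empty.2 hempty
  have hrR : r ≤ R := by
    obtain ⟨a, b, ha, hb, hab, -⟩ := hp
    exact le_rsNumber hr (hrk k (by omega)) a b ha hb hab
  -- The least `N` with `16 R < N r`; since `r ≤ R`, also `N r ≤ 17 R`.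
  set N := 16 * R / r + 1 with hN
  have hlt : 16 * R < N * r := by
    rw [mul_comm N]
    exact Nat.lt_mul_div_succ _ hr
  have hNr : N * r ≤ 17 * R := by
    have := Nat.div_mul_le_self (16 * R) r
    rw [hN, add_mul]
    omega
  set m := (matchingSides G k).ncard with hm
  have hm1 : (1 : ℝ) ≤ m := by
    have : 0 < m := (Set.ncard_pos (Set.toFinite _)).2 ⟨p, hp⟩
    exact_mod_cast this
  -- The bound is `2 k (1 + l)`, and `1 ≤ 2 l`.
  have hlogm : Real.log m ≤ 6 * k * l := by
    have h1 : (m : ℝ) ≤ (Real.exp 1 / α) ^ (2 * k) := by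
      have h2 : (m : ℝ) ≤ (n.choose k : ℝ) ^ 2 := by
        exact_mod_cast ncard_matchingSides_le G k
      have h3 := choose_le_exp_mul_pow (n := n) (k := k) (by omega) hα hk2
      rw [mul_comm, pow_mul]
      exact h2.trans (pow_le_pow_left₀ (by positivity) h3 2)
    have h2 := Real.log_le_log (by linarith) h1
    rw [Real.log_pow, div_eq_mul_one_div, Real.log_mul (Real.exp_ne_zero _) (by positivity),
      Real.log_exp, ← hl] at h2
    have hk0 : (0 : ℝ) ≤ k := by positivity
    push_cast at h2
    nlinarith
  obtain ⟨H, hHG, hHs, hH⟩ := exists_hitting_subgraph G (k := k) (N := N) (β := α / 8)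
    (Nat.le_add_left 1 _)
    (by omega) hr hrk hlt (⌊4 * N * Real.log m⌋₊ + 1)
    (by push_cast; exact Nat.lt_floor_add_one _)
  refine ⟨H, isMatchingCover_of_hitting hHG hk1 ?_, ?_⟩
  · intro a b ha hb hab hG
    classical
    obtain ⟨u, hu, w, hw, huw⟩ := hH (Finset.univ.image a, Finset.univ.image b)
      ⟨a, b, ha, hb, hab, hG, by simp, by simp⟩
    simp only [Finset.mem_image, Finset.mem_univ, true_and] at hu hw
    obtain ⟨x, rfl⟩ := hu
    obtain ⟨y, rfl⟩ := hw
    exact ⟨x, y, huw⟩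
  · have h1 : (H.edgeSet.ncard : ℝ) ≤ 4 * N * Real.log m + 1 := by
      have h2 : (H.edgeSet.ncard : ℝ) ≤ (⌊4 * N * Real.log m⌋₊ : ℝ) + 1 := by exact_mod_cast hHs
      have h3 := Nat.floor_le (show 0 ≤ 4 * N * Real.log m from
        mul_nonneg (by positivity) (Real.log_nonneg hm1))
      linarith
    have hr1 : (1 : ℝ) ≤ r := by exact_mod_cast hr
    -- From `k ≤ α n + 1 ≤ 8 r + r`.
    have hk9 : (k : ℝ) ≤ 9 * r := by linarith
    have hNr' : (N : ℝ) * r ≤ 17 * R := by exact_mod_cast hNr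
    have hR1 : (1 : ℝ) ≤ R := by exact_mod_cast hr.trans hrR
    have hl0 : 0 ≤ l := by linarith
    have hN0 : (0 : ℝ) ≤ N := by positivity
    calc (H.edgeSet.ncard : ℝ) ≤ 4 * N * Real.log m + 1 := h1
      _ ≤ 4 * N * (6 * (9 * r) * l) + 2 * (R * l) := by
        gcongr
        · exact hlogm.trans (by gcongr)
        · nlinarith
      _ = 216 * (N * r) * l + 2 * (R * l) := by ring
      _ ≤ 216 * (17 * R) * l + 2 * (R * l) := by gcongr
      _ ≤ R * (4000 * l) := by
        have : 0 ≤ R * l := by positivity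
        nlinarith
end MatchingCover

theorem mainTheorem10 :
    ∃ C : ℝ, 0 < C ∧
      ∀ (α : ℝ), 0 < α → α < 1 →
      ∀ (n : ℕ), 1 ≤ n →
      ∀ (V : Type*) [Fintype V], Fintype.card V = n →
      ∀ G : SimpleGraph V,
        ∃ H : SimpleGraph V, MatchingCover.IsMatchingCover α G H ∧
          (H.edgeSet.ncard : ℝ) ≤
            (MatchingCover.rsNumber n (α / 8) : ℝ) * (C * Real.log (1 / α)) := by
  refine ⟨4000, by norm_num, ?_⟩
  rintro α hα hα1 n hn V _ rfl G
  by_cases hα2 : α < 1 / 2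
  · exact MatchingCover.exists_matchingCover hα hα2 hn G
  · refine ⟨⊥, MatchingCover.isMatchingCover_bot (not_lt.1 hα2) G, ?_⟩
    have := Real.log_nonneg ((one_le_div hα).2 hα1.le)
    simp only [SimpleGraph.edgeSet_bot, Set.ncard_empty, Nat.cast_zero]
    positivity
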